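/- Let $N\ge 2$ be an integer and let $0<\alpha\le 2$ with $\alpha\ne N$. Let $E\subset\mathbb{R}^N$ be a compact set whose minimum $\alpha$-energy $$W_\alpha(E)=\inf_\mu \iint |x-t|^{\alpha-N}\,d\mu(t)\,d\mu(x)$$ is finite, where the infimum is over all Borel probability measures $\mu$ carried by $E$. Let $\mu_\alpha$ be the $\alpha$-equilibrium measure of $E$, that is, the Borel probability measure carried by $E$ that attains this infimum. Let $d_E(x)=\sup_{t\in E}|x-t|$ and, for $m\ge 2$, $$C_E(\alpha,m)=\min_{c_1,\dots,c_m\in E}\int \min_{1\le k\le m}|x-c_k|^{\alpha-N}\,d\mu_\alpha(x)-W_\alpha(E),\qquad C_E(\alpha)=\int d_E(x)^{\alpha-N}\,d\mu_\alpha(x)-W_\alpha(E),$$ where the minimum is finite and attained. A closed set $S\subset E$ is called dominant if $d_E(x)=\max_{t\in S}|x-t|$ for all $x\in\operatorname{supp}(\mu_\alpha)$. A minimal dominant set $\mathfrak{D}_E$ is a dominant set with the smallest number of points, $\operatorname{card}(\mathfrak{D}_E)$; if there is no finite dominant set, then any dominant set is minimal and $\operatorname{card}(\mathfrak{D}_E)=\infty$.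 Then the following hold. 1. $C_E(\alpha,m)\ge C_E(\alpha)$ for every $m\ge 2$. 2. If $m\ge 2$ and $m<\operatorname{card}(\mathfrak{D}_E)$, then $C_E(\alpha,m)>C_E(\alpha)$; if $m\ge 2$ and $m\ge\operatorname{card}(\mathfrak{D}_E)$, then $C_E(\alpha,m)=C_E(\alpha)$. 3. The constants $C_E(\alpha,m)$ are (weakly) decreasing in $m\ge 2$, and $\lim_{m\to\infty}C_E(\alpha,m)=C_E(\alpha)$. -/

import Mathlib

open MeasureTheory Filter Topology
open scoped ENNReal NNReal

noncomputable section

namespace RieszReverse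

/-- The Riesz kernel `|x - y|^(α - N)` on `ℝ^N`, with value `∞` on the diagonal when `α < N`. -/
def kernel {N : ℕ} (α : ℝ) (x y : EuclideanSpace ℝ (Fin N)) : ℝ≥0∞ :=
  edist x y ^ (α - (N : ℝ))

/-- The Riesz potential `U_α^μ (x) = ∫ |x - t|^(α - N) dμ(t)`. -/
def potential {N : ℕ} (α : ℝ) (μ : Measure (EuclideanSpace ℝ (Fin N)))
    (x : EuclideanSpace ℝ (Fin N)) : ℝ≥0∞ :=
  ∫⁻ t, kernel α x t ∂μ

/-- The `α`-energy `∫ U_α^μ dμ` of `μ`. -/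
def energy {N : ℕ} (α : ℝ) (μ : Measure (EuclideanSpace ℝ (Fin N))) : ℝ≥0∞ :=
  ∫⁻ x, potential α μ x ∂μ

/-- The minimum `α`-energy `W_α(E)`: the infimum of the energies of all Borel probability
measures carried by `E` (it is `∞` if there is no such measure of finite energy). -/
def minEnergy {N : ℕ} (α : ℝ) (E : Set (EuclideanSpace ℝ (Fin N))) : ℝ≥0∞ :=
  ⨅ (μ : Measure (EuclideanSpace ℝ (Fin N))) (_ : IsProbabilityMeasure μ) (_ : μ Eᶜ = 0),
    energy α μ

/-- `μ` is an `α`-equilibrium measure of `E`: a Borel probability measure carried by `E` whose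
energy is the minimum `α`-energy of `E`. -/
structure IsEquilibriumMeasure {N : ℕ} (α : ℝ) (E : Set (EuclideanSpace ℝ (Fin N)))
    (μ : Measure (EuclideanSpace ℝ (Fin N))) : Prop where
  isProbabilityMeasure : IsProbabilityMeasure μ
  compl_eq_zero : μ Eᶜ = 0
  energy_eq : energy α μ = minEnergy α E

/-- The farthest distance function `d_E(x) = sup_{t ∈ E} |x - t|`. -/
def farthestDist {N : ℕ} (E : Set (EuclideanSpace ℝ (Fin N)))
    (x : EuclideanSpace ℝ (Fin N)) : ℝ≥0∞ :=
  ⨆ t ∈ E, edist x t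

/-- The integral `∫ min_{1 ≤ k ≤ m} |x - c_k|^(α - N) dμ(x)`. -/
def minKernelIntegral {N : ℕ} (α : ℝ) (μ : Measure (EuclideanSpace ℝ (Fin N))) {m : ℕ}
    (c : Fin m → EuclideanSpace ℝ (Fin N)) : ℝ≥0∞ :=
  ∫⁻ x, ⨅ k, kernel α x (c k) ∂μ

/-- The infimum of `∫ min_{1 ≤ k ≤ m} |x - c_k|^(α - N) dμ(x)` over all `c_1, …, c_m ∈ E`. -/
def infMinKernelIntegral {N : ℕ} (α : ℝ) (E : Set (EuclideanSpace ℝ (Fin N)))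
    (μ : Measure (EuclideanSpace ℝ (Fin N))) (m : ℕ) : ℝ≥0∞ :=
  ⨅ (c : Fin m → EuclideanSpace ℝ (Fin N)) (_ : ∀ k, c k ∈ E), minKernelIntegral α μ c

/-- The constant `C_E(α, m)`, where `μ` is the `α`-equilibrium measure of `E`. -/
def constM {N : ℕ} (α : ℝ) (E : Set (EuclideanSpace ℝ (Fin N)))
    (μ : Measure (EuclideanSpace ℝ (Fin N))) (m : ℕ) : ℝ :=
  (infMinKernelIntegral α E μ m).toReal - (minEnergy α E).toReal

/-- The constant `C_E(α) = ∫ d_E^(α - N) dμ - W_α(E)`, where `μ` is the `α`-equilibrium measure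
of `E`. -/
def constE {N : ℕ} (α : ℝ) (E : Set (EuclideanSpace ℝ (Fin N)))
    (μ : Measure (EuclideanSpace ℝ (Fin N))) : ℝ :=
  (∫⁻ x, farthestDist E x ^ (α - (N : ℝ)) ∂μ).toReal - (minEnergy α E).toReal

/-- A dominant set: a closed `S ⊆ E` with `d_E(x) = max_{t ∈ S} |x - t|` for all `x ∈ supp μ`,
where `μ` is the `α`-equilibrium measure of `E`. -/
structure IsDominant {N : ℕ} (E : Set (EuclideanSpace ℝ (Fin N)))
    (μ : Measure (EuclideanSpace ℝ (Fin N))) (S : Set (EuclideanSpace ℝ (Fin N))) : Prop where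
  isClosed : IsClosed S
  subset : S ⊆ E
  isGreatest : ∀ x ∈ μ.support, IsGreatest ((fun t => edist x t) '' S) (farthestDist E x)

/-- A minimal dominant set: a dominant set with the smallest number of points. The cardinality is
taken in `ℕ∞`, so that every dominant set is minimal if no finite one exists. -/
def IsMinimalDominant {N : ℕ} (E : Set (EuclideanSpace ℝ (Fin N)))
    (μ : Measure (EuclideanSpace ℝ (Fin N))) (D : Set (EuclideanSpace ℝ (Fin N))) : Prop :=
  IsDominant E μ D ∧ ∀ S, IsDominant E μ S → D.encard ≤ S.encard

/-- A compact set of finite minimum energy has an equilibrium measure. -/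
theorem exists_isEquilibriumMeasure {N : ℕ} {α : ℝ} {E : Set (EuclideanSpace ℝ (Fin N))}
    (hE : IsCompact E) (hW : minEnergy α E < ⊤) : ∃ μ, IsEquilibriumMeasure α E μ := by
  have hmeas : MeasurableSet E := hE.measurableSet
  have : CompactSpace E := isCompact_iff_compactSpace.mp hE
  have hkc : Continuous fun p : E × E => kernel α (p.1 : EuclideanSpace ℝ (Fin N)) p.2 := by
    unfold kernel
    exact ENNReal.continuous_rpow_const.comp (by fun_prop)
  -- the energy of a probability measure on the compact space `E`
  let F : ProbabilityMeasure E → ℝ≥0∞ := fun ν =>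
    ∫⁻ p, kernel α (p.1 : EuclideanSpace ℝ (Fin N)) p.2 ∂((ν.prod ν : ProbabilityMeasure (E × E)) :
      Measure (E × E))
  have hF : ∀ ν : ProbabilityMeasure E,
      F ν = energy α ((ν : Measure E).map (Subtype.val)) := by
    intro ν
    have hk2 : Continuous fun p : EuclideanSpace ℝ (Fin N) × EuclideanSpace ℝ (Fin N) =>
        kernel α p.1 p.2 := by
      unfold kernel
      exact ENNReal.continuous_rpow_const.comp (by fun_prop)
    simp only [F, energy, potential, ProbabilityMeasure.toMeasure_prod]
    rw [lintegral_prod _ hkc.measurable.aemeasurable,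
      lintegral_map (hk2.measurable.lintegral_prod_right') measurable_subtype_coe]
    refine lintegral_congr fun x => ?_
    have hx : Measurable fun t => kernel α (x : EuclideanSpace ℝ (Fin N)) t :=
      (hk2.comp (by fun_prop : Continuous fun t => ((x : EuclideanSpace ℝ (Fin N)), t))).measurable
    exact (lintegral_map hx measurable_subtype_coe).symm
  have hlsc : LowerSemicontinuous F := by
    have hsup : F = fun ν => ⨆ n : ℕ, ∫⁻ p,
        min (kernel α (p.1 : EuclideanSpace ℝ (Fin N)) p.2) (n : ℝ≥0∞)
          ∂((ν.prod ν : ProbabilityMeasure (E × E)) : Measure (E × E)) := by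
      funext ν
      rw [← lintegral_iSup (fun n => (hkc.min continuous_const).measurable)
        (fun i j hij p => min_le_min le_rfl (by exact_mod_cast hij))]
      refine lintegral_congr fun p => ?_
      rw [← inf_iSup_eq, ENNReal.iSup_natCast, inf_top_eq]
    rw [hsup]
    refine lowerSemicontinuous_iSup fun n => Continuous.lowerSemicontinuous ?_
    have hcont : Continuous fun p : E × E =>
        (min (kernel α (p.1 : EuclideanSpace ℝ (Fin N)) p.2) (n : ℝ≥0∞)).toNNReal := by
      refine continuous_iff_continuousAt.2 fun p => ?_
      exact (ENNReal.tendsto_toNNReal (ne_top_of_le_ne_top (ENNReal.natCast_ne_top n)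
        (min_le_right _ _))).comp (hkc.min continuous_const).continuousAt
    let g : BoundedContinuousFunction (E × E) ℝ≥0 :=
      BoundedContinuousFunction.mkOfCompact ⟨_, hcont⟩
    have hg : ∀ p : E × E, ((g p : ℝ≥0) : ℝ≥0∞) =
        min (kernel α (p.1 : EuclideanSpace ℝ (Fin N)) p.2) (n : ℝ≥0∞) := fun p =>
      ENNReal.coe_toNNReal (ne_top_of_le_ne_top (ENNReal.natCast_ne_top n) (min_le_right _ _))
    simp only [← hg]
    have hp : Continuous fun ν : ProbabilityMeasure E => ν.prod ν :=
      ProbabilityMeasure.continuous_prod.comp (continuous_id.prodMk continuous_id)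
    refine continuous_iff_continuousAt.2 fun ν => ?_
    exact (ProbabilityMeasure.tendsto_iff_forall_lintegral_tendsto.1 (hp.tendsto ν)) g
  -- every admissible measure on `ℝ^N` comes from a probability measure on `E`
  have hlift : ∀ μ : Measure (EuclideanSpace ℝ (Fin N)), IsProbabilityMeasure μ → μ Eᶜ = 0 →
      ∃ ν : ProbabilityMeasure E, (ν : Measure E).map Subtype.val = μ := by
    intro μ hμ hμE
    have hmap : (μ.comap (Subtype.val : E → _)).map Subtype.val = μ := by
      rw [map_comap_subtype_coe hmeas]
      exact Measure.restrict_eq_self_of_ae_mem (mem_ae_iff.2 hμE)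
    have hprob : IsProbabilityMeasure (μ.comap (Subtype.val : E → _)) := by
      constructor
      have := congrArg (fun ρ => ρ Set.univ) hmap
      simp only [Measure.map_apply measurable_subtype_coe MeasurableSet.univ,
        Set.preimage_univ, measure_univ] at this
      exact this
    exact ⟨⟨_, hprob⟩, hmap⟩
  have hne : Nonempty (ProbabilityMeasure E) := by
    by_contra hcon
    refine hW.ne (iInf_eq_top.2 fun μ => iInf_eq_top.2 fun h1 => iInf_eq_top.2 fun h2 => ?_)
    exact absurd ⟨(hlift μ h1 h2).choose⟩ hcon
  obtain ⟨ν, -, hν⟩ := LowerSemicontinuousOn.exists_isMinOn (s := Set.univ)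
    Set.univ_nonempty isCompact_univ (hlsc.lowerSemicontinuousOn _)
  have hpν : IsProbabilityMeasure ((ν : Measure E).map Subtype.val) :=
    Measure.isProbabilityMeasure_map measurable_subtype_coe.aemeasurable
  have hcν : ((ν : Measure E).map Subtype.val) Eᶜ = 0 := by
    rw [Measure.map_apply measurable_subtype_coe hmeas.compl]
    simp
  refine ⟨_, hpν, hcν, le_antisymm ?_ ?_⟩
  · refine le_iInf fun μ => le_iInf fun h1 => le_iInf fun h2 => ?_
    obtain ⟨ν', rfl⟩ := hlift μ h1 h2
    rw [← hF, ← hF]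
    exact hν (Set.mem_univ ν')
  · exact iInf_le_of_le _ (iInf_le_of_le hpν (iInf_le _ hcν))

/-- A nonempty compact set has a minimal dominant set. -/
theorem exists_isMinimalDominant {N : ℕ} {E : Set (EuclideanSpace ℝ (Fin N))}
    (μ : Measure (EuclideanSpace ℝ (Fin N))) (hE : IsCompact E) (hne : E.Nonempty) :
    ∃ D, IsMinimalDominant E μ D := by
  have hEd : IsDominant E μ E := by
    refine ⟨hE.isClosed, subset_rfl, fun x _ => ?_⟩
    obtain ⟨t, ht, hmax⟩ := hE.exists_isMaxOn hne
      (f := fun t => edist x t) (by fun_prop)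
    have : farthestDist E x = edist x t :=
      le_antisymm (iSup₂_le fun s hs => hmax hs) (le_iSup₂_of_le t ht le_rfl)
    refine ⟨⟨t, ht, this.symm⟩, ?_⟩
    rintro _ ⟨s, hs, rfl⟩
    exact le_iSup₂_of_le s hs le_rfl
  obtain ⟨D, hD, hmin⟩ := (InvImage.wf (fun S : Set (EuclideanSpace ℝ (Fin N)) => S.encard)
    (wellFounded_lt (α := ℕ∞))).has_min {S | IsDominant E μ S} ⟨E, hEd⟩
  exact ⟨D, hD, fun S hS => not_lt.1 (hmin S hS)⟩

end RieszReverse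

end

namespace RieszReverse

/-! Since `α ≤ 2 ≤ N` and `α ≠ N`, the exponent `α - N` is negative, so the minimum of the kernels
at `c_1, …, c_m` is the `(α - N)`-th power of the largest distance to these points. That distance is
at most `d_E`, which gives the inequality between the constants; `W_α(E)` is only a common shift.

If the integrals agree at a minimizing configuration, the integrands agree almost everywhere, hence
the largest distance is `d_E` on the whole support by a closedness argument. The configuration is
then a dominant set with at most `m` points (`isDominant_range`), so too small an `m` forces strict
inequality. Conversely, a dominant set with at most `m` points, padded by repetition, attains the
bound.

For the limit, initial segments of a dense sequence in `E` give integrands decreasing to `d_E ^ (α -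
N)`, and monotone convergence applies. -/

theorem _root_.ENNReal.iSup_rpow_of_neg {ι : Sort*} (f : ι → ℝ≥0∞) {s : ℝ} (hs : s < 0) :
    (⨆ i, f i) ^ s = ⨅ i, f i ^ s := by
  have h : ∀ x : ℝ≥0∞, x ^ s = (ENNReal.orderIsoRpow (-s) (neg_pos.2 hs) x)⁻¹ := fun x => by
    rw [ENNReal.orderIsoRpow_apply, ENNReal.rpow_neg, inv_inv]
  simp only [h, OrderIso.map_iSup, ENNReal.inv_iSup]

theorem _root_.ENNReal.rpow_le_rpow_iff_of_neg {x y : ℝ≥0∞} {s : ℝ} (hs : s < 0) :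
    x ^ s ≤ y ^ s ↔ y ≤ x := by
  rw [← neg_neg s, ENNReal.rpow_neg x, ENNReal.rpow_neg y, ENNReal.inv_le_inv,
    ENNReal.rpow_le_rpow_iff (neg_pos.2 hs)]

variable {N : ℕ} {α : ℝ} {E : Set (EuclideanSpace ℝ (Fin N))}
  {μ : Measure (EuclideanSpace ℝ (Fin N))}

/-! ### Attainment, monotonicity and finiteness of the minimum -/

theorem iInf_kernel_eq (hα : α < N) {ι : Sort*} (x : EuclideanSpace ℝ (Fin N))
    (c : ι → EuclideanSpace ℝ (Fin N)) :
    ⨅ k, kernel α x (c k) = (⨆ k, edist x (c k)) ^ (α - (N : ℝ)) :=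
  (ENNReal.iSup_rpow_of_neg _ (sub_neg.2 hα)).symm

theorem continuous_iInf_kernel (α : ℝ) (m : ℕ) :
    Continuous fun p : (Fin m → EuclideanSpace ℝ (Fin N)) × EuclideanSpace ℝ (Fin N) =>
      ⨅ k, kernel α p.2 (p.1 k) := by
  have hk : ∀ k, Continuous fun p : (Fin m → EuclideanSpace ℝ (Fin N)) ×
      EuclideanSpace ℝ (Fin N) => kernel α p.2 (p.1 k) := fun k =>
    ENNReal.continuous_rpow_const.comp
      (continuous_snd.edist ((continuous_apply k).comp continuous_fst))
  simp only [← Finset.inf_univ_eq_iInf]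
  exact Continuous.finset_inf_apply fun k _ => hk k

theorem measurable_iInf_kernel (α : ℝ) {m : ℕ} (c : Fin m → EuclideanSpace ℝ (Fin N)) :
    Measurable fun x => ⨅ k, kernel α x (c k) :=
  ((continuous_iInf_kernel α m).comp (by fun_prop :
    Continuous fun x : EuclideanSpace ℝ (Fin N) => (c, x))).measurable

/-- Fatou's lemma, since the integrand is continuous in `c` with values in `[0, ∞]`; no dominating
function is needed. -/
theorem lowerSemicontinuous_minKernelIntegral (α : ℝ)
    (μ : Measure (EuclideanSpace ℝ (Fin N))) (m : ℕ) :
    LowerSemicontinuous fun c : Fin m → EuclideanSpace ℝ (Fin N) => minKernelIntegral α μ c := by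
  refine lowerSemicontinuous_iff_le_liminf.2 fun c => ?_
  refine le_trans (lintegral_mono fun x => ?_)
    (lintegral_liminf_le fun c' => measurable_iInf_kernel α c')
  exact (((continuous_iInf_kernel α m).comp (by fun_prop :
    Continuous fun c : Fin m → EuclideanSpace ℝ (Fin N) => (c, x))).tendsto c).liminf_eq.ge

/-- The infimum over `m`-point configurations in a nonempty compact set is attained. -/
theorem exists_minKernelIntegral_eq (hE : IsCompact E) (hne : E.Nonempty) (α : ℝ)
    (μ : Measure (EuclideanSpace ℝ (Fin N))) (m : ℕ) :
    ∃ c : Fin m → EuclideanSpace ℝ (Fin N), (∀ k, c k ∈ E) ∧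
      minKernelIntegral α μ c = infMinKernelIntegral α E μ m := by
  obtain ⟨c, hc, hmin⟩ := LowerSemicontinuousOn.exists_isMinOn
    (Set.univ_pi_nonempty_iff.2 fun _ : Fin m => hne)
    (isCompact_univ_pi fun _ => hE)
    ((lowerSemicontinuous_minKernelIntegral α μ m).lowerSemicontinuousOn _)
  have hc' : ∀ k, c k ∈ E := fun k => hc k (Set.mem_univ k)
  refine ⟨c, hc', le_antisymm ?_ (iInf₂_le c hc')⟩
  exact le_iInf₂ fun c' h => hmin fun k _ => h k

theorem minKernelIntegral_le_of_range_subset {m m' : ℕ}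
    {c : Fin m → EuclideanSpace ℝ (Fin N)} {c' : Fin m' → EuclideanSpace ℝ (Fin N)}
    (h : Set.range c ⊆ Set.range c') : minKernelIntegral α μ c' ≤ minKernelIntegral α μ c := by
  refine lintegral_mono fun x => le_iInf fun k => ?_
  obtain ⟨k', hk'⟩ := h ⟨k, rfl⟩
  exact iInf_le_of_le k' (by rw [hk'])

theorem infMinKernelIntegral_anti {m : ℕ} (hm : 0 < m) {m' : ℕ} (h : m ≤ m') :
    infMinKernelIntegral α E μ m' ≤ infMinKernelIntegral α E μ m := by
  refine le_iInf₂ fun c hc => ?_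
  -- Pads `c` to `m'` points by repeating its last point; this needs `0 < m`.
  let r : Fin m' → Fin m := fun i => ⟨min i (m - 1), by omega⟩
  refine iInf₂_le_of_le (c ∘ r) (fun k => hc _) (minKernelIntegral_le_of_range_subset ?_)
  rintro _ ⟨k, rfl⟩
  refine ⟨⟨k, by omega⟩, congrArg c (Fin.ext ?_)⟩
  simp only [r]
  omega

/-- A set of finite minimum energy has at least two points. -/
theorem nontrivial_of_minEnergy_lt_top (hα : α < N) (hW : minEnergy α E < ⊤) :
    E.Nontrivial := by
  by_contra hE
  rw [Set.not_nontrivial_iff] at hE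
  refine hW.ne (iInf_eq_top.2 fun μ => iInf_eq_top.2 fun h1 => iInf_eq_top.2 fun h2 => ?_)
  have hae : ∀ᵐ x ∂μ, x ∈ E := mem_ae_iff.2 h2
  have hpot : ∀ᵐ x ∂μ, potential α μ x = ⊤ := by
    filter_upwards [hae] with x hx
    have : ∀ᵐ t ∂μ, kernel α x t = ⊤ := by
      filter_upwards [hae] with t ht
      rw [kernel, hE hx ht, edist_self, ENNReal.zero_rpow_of_neg (sub_neg.2 hα)]
    rw [potential, lintegral_congr_ae this]
    simp
  rw [energy, lintegral_congr_ae hpot]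
  simp

/-- By the triangle inequality, every `x` is at distance at least `|a - b| / 2` from `a` or from
`b`. Two distinct points thus bound the integrand uniformly. -/
theorem iInf_kernel_le_of_mem_range (hα : α < N) {ι : Sort*}
    {c : ι → EuclideanSpace ℝ (Fin N)} {a b : EuclideanSpace ℝ (Fin N)}
    (ha : a ∈ Set.range c) (hb : b ∈ Set.range c) (x : EuclideanSpace ℝ (Fin N)) :
    ⨅ k, kernel α x (c k) ≤ (edist a b / 2) ^ (α - (N : ℝ)) := by
  rw [iInf_kernel_eq hα, ENNReal.rpow_le_rpow_iff_of_neg (sub_neg.2 hα)]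
  obtain ⟨i, rfl⟩ := ha
  obtain ⟨j, rfl⟩ := hb
  refine ENNReal.div_le_of_le_mul ?_
  calc edist (c i) (c j) ≤ edist x (c i) + edist x (c j) := by
        rw [edist_comm x (c i)]; exact edist_triangle _ _ _
    _ ≤ (⨆ k, edist x (c k)) + ⨆ k, edist x (c k) :=
        add_le_add (le_iSup (fun k => edist x (c k)) i) (le_iSup (fun k => edist x (c k)) j)
    _ = (⨆ k, edist x (c k)) * 2 := (mul_two _).symm

theorem minKernelIntegral_lt_top (hα : α < N) [IsProbabilityMeasure μ] {m : ℕ}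
    {c : Fin m → EuclideanSpace ℝ (Fin N)} {a b : EuclideanSpace ℝ (Fin N)} (hab : a ≠ b)
    (ha : a ∈ Set.range c) (hb : b ∈ Set.range c) : minKernelIntegral α μ c < ⊤ := by
  refine (lintegral_mono (iInf_kernel_le_of_mem_range hα ha hb)).trans_lt ?_
  rw [lintegral_const, measure_univ, mul_one, lt_top_iff_ne_top]
  refine ENNReal.rpow_ne_top_of_ne_zero ?_ ?_
  · simpa [ENNReal.div_eq_zero_iff] using hab
  · exact ENNReal.div_ne_top (edist_ne_top a b) two_ne_zero

theorem infMinKernelIntegral_lt_top (hα : α < N) [IsProbabilityMeasure μ] (hE : E.Nontrivial)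
    {m : ℕ} (hm : 2 ≤ m) : infMinKernelIntegral α E μ m < ⊤ := by
  obtain ⟨a, ha, b, hb, hab⟩ := hE
  refine (infMinKernelIntegral_anti two_pos hm).trans_lt
    ((iInf₂_le ![a, b] ?_).trans_lt (minKernelIntegral_lt_top hα hab ⟨0, rfl⟩ ⟨1, rfl⟩))
  intro k
  fin_cases k
  · exact ha
  · exact hb

/-! ### Comparison with the farthest distance; dominant sets -/

theorem iSup_edist_le_farthestDist {ι : Sort*} {c : ι → EuclideanSpace ℝ (Fin N)}
    (hc : ∀ k, c k ∈ E) (x : EuclideanSpace ℝ (Fin N)) :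
    ⨆ k, edist x (c k) ≤ farthestDist E x :=
  iSup_le fun k => le_iSup₂_of_le (c k) (hc k) le_rfl

theorem farthestDist_rpow_le_iInf_kernel (hα : α < N) {ι : Sort*}
    {c : ι → EuclideanSpace ℝ (Fin N)} (hc : ∀ k, c k ∈ E) (x : EuclideanSpace ℝ (Fin N)) :
    farthestDist E x ^ (α - (N : ℝ)) ≤ ⨅ k, kernel α x (c k) := by
  rw [iInf_kernel_eq hα, ENNReal.rpow_le_rpow_iff_of_neg (sub_neg.2 hα)]
  exact iSup_edist_le_farthestDist hc x

theorem lintegral_farthestDist_rpow_le (hα : α < N) (E : Set (EuclideanSpace ℝ (Fin N)))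
    (μ : Measure (EuclideanSpace ℝ (Fin N))) (m : ℕ) :
    ∫⁻ x, farthestDist E x ^ (α - (N : ℝ)) ∂μ ≤ infMinKernelIntegral α E μ m :=
  le_iInf₂ fun _ hc => lintegral_mono (farthestDist_rpow_le_iInf_kernel hα hc)

/-- A configuration whose integral equals `∫ d_E ^ (α - N) dμ` is a dominant set. -/
theorem isDominant_range (hα : α < N) {m : ℕ} (hm : 0 < m)
    {c : Fin m → EuclideanSpace ℝ (Fin N)} (hc : ∀ k, c k ∈ E)
    (hfin : ∫⁻ x, farthestDist E x ^ (α - (N : ℝ)) ∂μ ≠ ⊤)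
    (h : minKernelIntegral α μ c ≤ ∫⁻ x, farthestDist E x ^ (α - (N : ℝ)) ∂μ) :
    IsDominant E μ (Set.range c) := by
  have hae := ae_eq_of_ae_le_of_lintegral_le
    (ae_of_all μ (farthestDist_rpow_le_iInf_kernel hα hc)) hfin
    (measurable_iInf_kernel α c).aemeasurable h
  have hcont : Continuous fun x => ⨆ k, edist x (c k) := by
    simp only [← Finset.sup_univ_eq_iSup]
    exact Continuous.finset_sup_apply fun k _ => by fun_prop
  -- An intersection over `t ∈ E` of closed conditions. A closed set of full measure contains the
  -- support, so the almost everywhere equality holds at every point of it.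
  have hclosed : IsClosed {x | farthestDist E x ≤ ⨆ k, edist x (c k)} := by
    simp only [farthestDist, iSup_le_iff, Set.ofPred_forall]
    exact isClosed_biInter fun t _ => isClosed_le (by fun_prop) hcont
  have hsub : μ.support ⊆ {x | farthestDist E x ≤ ⨆ k, edist x (c k)} := by
    refine Measure.support_subset_of_isClosed hclosed ?_
    filter_upwards [hae] with x hx
    rw [← ENNReal.rpow_le_rpow_iff_of_neg (sub_neg.2 hα), ← iInf_kernel_eq hα]
    exact hx.ge
  refine ⟨(Set.finite_range c).isClosed, Set.range_subset_iff.2 hc, fun x hx => ⟨?_, ?_⟩⟩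
  · have : Nonempty (Fin m) := ⟨⟨0, hm⟩⟩
    obtain ⟨k, hk⟩ := exists_eq_ciSup_of_finite (f := fun k => edist x (c k))
    exact ⟨c k, ⟨k, rfl⟩, hk.trans (le_antisymm (iSup_edist_le_farthestDist hc x) (hsub hx))⟩
  · rintro _ ⟨_, ⟨k, rfl⟩, rfl⟩
    exact le_iSup₂_of_le (c k) (hc k) le_rfl

/-- A dominant set with at most `m` points gives an optimal `m`-point configuration. -/
theorem infMinKernelIntegral_le_of_isDominant (hα : α < N) [IsProbabilityMeasure μ]
    {D : Set (EuclideanSpace ℝ (Fin N))} (hD : IsDominant E μ D) {m : ℕ} (hm : D.encard ≤ m) :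
    infMinKernelIntegral α E μ m ≤ ∫⁻ x, farthestDist E x ^ (α - (N : ℝ)) ∂μ := by
  have hfin : D.Finite := Set.finite_of_encard_le_coe hm
  -- A point of the support has a farthest point in `D`, so `D` is nonempty and can be padded.
  obtain ⟨y, hy⟩ := Measure.nonempty_support (IsProbabilityMeasure.ne_zero μ)
  obtain ⟨t, ht, -⟩ := (hD.isGreatest y hy).1
  have hcard : D.ncard ≤ m := by
    rwa [← hfin.cast_ncard_eq, Nat.cast_le] at hm
  have hpos : 0 < D.ncard := (Set.ncard_pos hfin).2 ⟨t, ht⟩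
  refine (infMinKernelIntegral_anti hpos hcard).trans ?_
  have : Finite D := hfin
  let e : Fin D.ncard ≃ D := (Finite.equivFinOfCardEq rfl).symm
  refine iInf₂_le_of_le (fun k => (e k : EuclideanSpace ℝ (Fin N)))
    (fun k => hD.subset (e k).2) (lintegral_mono_ae ?_)
  filter_upwards [Measure.support_mem_ae (μ := μ)] with x hx
  rw [iInf_kernel_eq hα, ENNReal.rpow_le_rpow_iff_of_neg (sub_neg.2 hα)]
  obtain ⟨s, hs, hsx⟩ := (hD.isGreatest x hx).1
  rw [← hsx]
  refine le_iSup_of_le (e.symm ⟨s, hs⟩) ?_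
  simp

/-! ### The limit as `m → ∞` -/

theorem farthestDist_eq_iSup_of_dense {ι : Sort*} {q : ι → EuclideanSpace ℝ (Fin N)}
    (hq : ∀ k, q k ∈ E) (hd : E ⊆ closure (Set.range q)) (x : EuclideanSpace ℝ (Fin N)) :
    farthestDist E x = ⨆ k, edist x (q k) := by
  refine le_antisymm (iSup₂_le fun t ht => ?_) (iSup_edist_le_farthestDist hq x)
  have hclosed : IsClosed {t | edist x t ≤ ⨆ k, edist x (q k)} :=
    isClosed_le (by fun_prop) continuous_const
  refine closure_minimal ?_ hclosed (hd ht)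
  rintro _ ⟨k, rfl⟩
  exact le_iSup (fun k => edist x (q k)) k

theorem iInf_infMinKernelIntegral_le (hα : α < N) [IsProbabilityMeasure μ]
    (hE : E.Nontrivial) : ⨅ m, infMinKernelIntegral α E μ (m + 2) ≤
      ∫⁻ x, farthestDist E x ^ (α - (N : ℝ)) ∂μ := by
  obtain ⟨a, ha, b, hb, hab⟩ := hE
  have : Nonempty E := ⟨⟨a, ha⟩⟩
  obtain ⟨u, hu⟩ := TopologicalSpace.exists_dense_seq E
  -- Starting with two distinct points makes the first integral finite, as monotone convergence for
  -- a decreasing sequence requires.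
  let q : ℕ → EuclideanSpace ℝ (Fin N)
    | 0 => a
    | 1 => b
    | n + 2 => u n
  have hq : ∀ k, q k ∈ E
    | 0 => ha
    | 1 => hb
    | n + 2 => (u n).2
  have hd : E ⊆ closure (Set.range q) := by
    intro t ht
    have h1 := (continuous_subtype_val.range_subset_closure_image_dense hu) ⟨⟨t, ht⟩, rfl⟩
    refine closure_mono ?_ h1
    rintro _ ⟨_, ⟨n, rfl⟩, rfl⟩
    exact ⟨n + 2, rfl⟩
  let c : (m : ℕ) → Fin (m + 2) → EuclideanSpace ℝ (Fin N) := fun m k => q k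
  have hanti : Antitone fun m x => ⨅ k, kernel α x (c m k) := by
    intro m m' h x
    exact le_iInf fun k => iInf_le_of_le (Fin.castLE (by omega) k) le_rfl
  have hlim : ∀ x, ⨅ m, ⨅ k, kernel α x (c m k) = farthestDist E x ^ (α - (N : ℝ)) := by
    intro x
    rw [farthestDist_eq_iSup_of_dense hq hd, ← iInf_kernel_eq hα]
    refine le_antisymm (le_iInf fun k => ?_) (le_iInf fun m => le_iInf fun k => iInf_le _ _)
    exact iInf_le_of_le k (iInf_le_of_le ⟨k, by omega⟩ le_rfl)
  have hI := lintegral_iInf (μ := μ) (fun m => measurable_iInf_kernel α (c m)) hanti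
    (minKernelIntegral_lt_top (c := c 0) hα hab ⟨0, rfl⟩ ⟨1, rfl⟩).ne
  simp only [hlim] at hI
  rw [hI]
  exact iInf_mono fun m => iInf₂_le (c m) fun k : Fin (m + 2) => hq k

theorem tendsto_infMinKernelIntegral (hα : α < N) [IsProbabilityMeasure μ]
    (hE : E.Nontrivial) : Tendsto (infMinKernelIntegral α E μ) atTop
      (𝓝 (∫⁻ x, farthestDist E x ^ (α - (N : ℝ)) ∂μ)) := by
  rw [← tendsto_add_atTop_iff_nat 2, ← le_antisymm (iInf_infMinKernelIntegral_le hα hE)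
    (le_iInf fun m => lintegral_farthestDist_rpow_le hα E μ (m + 2))]
  exact tendsto_atTop_iInf fun m m' h => infMinKernelIntegral_anti (by omega) (by omega)

end RieszReverse

open RieszReverse in
theorem corollary2p4 (N : ℕ) (hN : 2 ≤ N) (α : ℝ) (hα0 : 0 < α) (hα2 : α ≤ 2)
    (hαN : α ≠ (N : ℝ)) (E : Set (EuclideanSpace ℝ (Fin N))) (hE : IsCompact E)
    (hW : RieszReverse.minEnergy α E < ⊤)
    (μ : MeasureTheory.Measure (EuclideanSpace ℝ (Fin N)))
    (hμ : RieszReverse.IsEquilibriumMeasure α E μ) :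
    -- the minimum in the definition of `C_E(α, m)` is finite and attained
    (∀ m : ℕ, 2 ≤ m →
      RieszReverse.infMinKernelIntegral α E μ m < ⊤ ∧
      ∃ c : Fin m → EuclideanSpace ℝ (Fin N), (∀ k, c k ∈ E) ∧
        RieszReverse.minKernelIntegral α μ c = RieszReverse.infMinKernelIntegral α E μ m) ∧
    (∀ m : ℕ, 2 ≤ m → RieszReverse.constE α E μ ≤ RieszReverse.constM α E μ m) ∧
    (∀ D : Set (EuclideanSpace ℝ (Fin N)), RieszReverse.IsMinimalDominant E μ D →
      ∀ m : ℕ, 2 ≤ m →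
        ((m : ℕ∞) < D.encard → RieszReverse.constE α E μ < RieszReverse.constM α E μ m) ∧
        (D.encard ≤ (m : ℕ∞) → RieszReverse.constM α E μ m = RieszReverse.constE α E μ)) ∧
    AntitoneOn (fun m : ℕ => RieszReverse.constM α E μ m) (Set.Ici 2) ∧
    Filter.Tendsto (fun m : ℕ => RieszReverse.constM α E μ m) Filter.atTop
      (nhds (RieszReverse.constE α E μ)) := by

  have hα : α < N := lt_of_le_of_ne (hα2.trans (by exact_mod_cast hN)) hαN
  have hprob := hμ.isProbabilityMeasure
  have hEn := nontrivial_of_minEnergy_lt_top hα hW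
  have hfin := fun m (hm : 2 ≤ m) => infMinKernelIntegral_lt_top (μ := μ) hα hEn hm
  have hle := lintegral_farthestDist_rpow_le hα E μ
  have hfin' := ne_top_of_le_ne_top (hfin 2 le_rfl).ne (hle 2)
  have hmin := exists_minKernelIntegral_eq hE hEn.nonempty α μ
  refine ⟨fun m hm => ⟨hfin m hm, hmin m⟩, fun m hm => ?_, fun D hD m hm => ⟨fun hlt => ?_,
    fun hDm => ?_⟩, fun m hm m' _ h => ?_, ?_⟩
  · exact sub_le_sub_right (ENNReal.toReal_mono (hfin m hm).ne (hle m)) _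
  · refine sub_lt_sub_right ((ENNReal.toReal_lt_toReal hfin' (hfin m hm).ne).2 ?_) _
    by_contra hcon
    obtain ⟨c, hc, hceq⟩ := hmin m
    have hdom := isDominant_range hα (by omega) hc hfin' (hceq.le.trans (not_lt.1 hcon))
    -- Minimality of `D` would give the range of `c` more than `m` points.
    refine absurd (hlt.trans_le (hD.2 _ hdom)) (not_lt.2 ?_)
    rw [← Set.image_univ]
    refine (Set.encard_image_le c Set.univ).trans ?_
    simp
  · exact congrArg (fun w => ENNReal.toReal w - (minEnergy α E).toReal)
      (le_antisymm (infMinKernelIntegral_le_of_isDominant hα hD.1 hDm) (hle m))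
  · have hm' : 2 ≤ m := hm
    exact sub_le_sub_right (ENNReal.toReal_mono (hfin m hm).ne
      (infMinKernelIntegral_anti (by omega) h)) _
  · exact ((ENNReal.tendsto_toReal hfin').comp
      (tendsto_infMinKernelIntegral hα hEn)).sub_const _
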